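/- **Theorem (differential reproducing property on Riemannian manifolds).** *Conventions.* For a smooth manifold $X$ let $T^0X=X$ and $T^{k}X=T(T^{k-1}X)$. For $f\in C^k(X)$ the $k$-order differential $D^kf:T^kX\to\mathbb R$ is defined by $D^0f=f$ and $D^kf=D(D^{k-1}f)$; for $y\in T^{k-1}X$ and $v\in T_y(T^{k-1}X)$ its value at $(y,v)\in T^kX$ is written $D^kf(y)\cdot v$. Given complete Riemannian metrics $g_k$ on $T^kX$ for all $k\ge 0$, put $$\|f\|_\infty=\sup_X|f|,\qquad \|D^kf\|_\infty=\sup_{y\in T^{k-1}X}\ \sup_{0\ne v\in T_y(T^{k-1}X)}\frac{|D^kf(y)\cdot v|}{\|v\|_{g_{k-1}}},\qquad \|f\|_{C_b^n}=\|f\|_\infty+\sum_{k=1}^n\|D^kf\|_\infty ,$$ and let $C_b^n(X)$ be the set of $f\in C^n(X)$ with $\|f\|_{C_b^n}<\infty$. For a function $K$ on $X\times X$, $D^{(k,l)}K$ denotes the $k$-order differential in the first variable and $l$-order differential in the second, and $$\|D^{(k,k)}K\|_\infty=\sup\frac{|D^{(k,k)}K(y,z)\cdot(v,w)|}{\|v\|_{g_{k-1}}\|w\|_{g_{k-1}}}$$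 over $y,z\in T^{k-1}X$ and nonzero $v\in T_y(T^{k-1}X)$, $w\in T_z(T^{k-1}X)$. *Statement.* Let $M$ be a finite-dimensional, Hausdorff, second countable smooth manifold without boundary. Let $g_k$ be complete Riemannian metrics on $T^kM$ (in particular $(M,g_0)$ is a complete Riemannian manifold), and let $G_j$ be complete Riemannian metrics on $T^j(M\times M)$; the spaces $C_b^n(M)$ and $C_b^n(M\times M)$ are taken with respect to these. Let $s\in\mathbb N$ (including $0$), let $K:M\times M\to\mathbb R$ be a Mercer kernel (symmetric and positive semidefinite) with $K\in C_b^{2s+1}(M\times M)$, and let $\mathcal H_K$ be its reproducing kernel Hilbert space, that is, the Hilbert space of functions on $M$ with $K(x,\cdot)\in\mathcal H_K$ and $f(x)=\langle f,K(x,\cdot)\rangle_{\mathcal H_K}$ for all $x\in M$, $f\in\mathcal H_K$. Then: 1. For all $1\le k\le s$, $y\in T^{k-1}M$ and $v\in T_y(T^{k-1}M)$, the function $D^{(k,0)}K(y,\cdot)\cdot v$ on $M$ belongs to $\mathcal H_K$. 2. Every $f\in\mathcal H_K$ is of class $C^s$, and for all such $k,y,v$ $$D^kf(y)\cdot v=\langle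 D^{(k,0)}K(y,\cdot)\cdot v,\ f\rangle_{\mathcal H_K}.$$ 3. For every $f\in\mathcal H_K$, in $[0,\infty]$, $$\|f\|_{C_b^s}\le \Big((s+1)\big(\|K\|_\infty+\textstyle\sum_{k=1}^s\|D^{(k,k)}K\|_\infty\big)\Big)^{1/2}\|f\|_{\mathcal H_K}.$$ If moreover the metrics $g_k$ and $G_j$ are compatible up to order $s$, in the sense that $\|D^{(k,k)}F\|_\infty\le\|D^{2k}F\|_\infty$ for all $1\le k\le s$ and all $F\in C^{2k}(M\times M)$ (the left side measured with $g_{k-1}$, the right side with $G_{2k-1}$), then the inclusion $\mathcal H_K\hookrightarrow C_b^s(M)$ is well defined and bounded: $$\|f\|_{C_b^s}\le\kappa\,\|f\|_{\mathcal H_K}\quad\text{for all } f\in\mathcal H_K,\qquad \kappa^2=(s+1)\,\|K\|_{C_b^{2s}}.$$ -/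

import Mathlib

open scoped Manifold ContDiff ENNReal Topology

universe u

/-- A finite-dimensional `C^∞` manifold without boundary, bundled with its model so that the
tangent bundle construction can be iterated. -/
structure SmoothManifold : Type (u + 1) where
  /-- the model vector space -/
  E : Type u
  [normedAddCommGroup : NormedAddCommGroup E]
  [normedSpace : NormedSpace ℝ E]
  [finiteDimensional : FiniteDimensional ℝ E]
  /-- the model space -/
  H : Type u
  [topModel : TopologicalSpace H]
  /-- the model with corners (without boundary) -/
  I : ModelWithCorners ℝ E H
  [boundaryless : I.Boundaryless]
  /-- the underlying set of points -/
  carrier : Type u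
  [top : TopologicalSpace carrier]
  [charted : ChartedSpace H carrier]
  [smooth : IsManifold I ∞ carrier]

namespace SmoothManifold

instance : CoeSort SmoothManifold.{u} (Type u) := ⟨SmoothManifold.carrier⟩

attribute [instance] normedAddCommGroup normedSpace finiteDimensional topModel boundaryless
  top charted smooth

/-- The product manifold `X × Y`. -/
noncomputable def prod (X Y : SmoothManifold.{u}) : SmoothManifold.{u} where
  E := X.E × Y.E
  H := ModelProd X.H Y.H
  I := X.I.prod Y.I
  carrier := X × Y

/-- The tangent bundle `T X` as a manifold. -/
noncomputable def tangent (X : SmoothManifold.{u}) : SmoothManifold.{u} where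
  E := X.E × X.E
  H := ModelProd X.H X.E
  I := X.I.tangent
  carrier := TangentBundle X.I X

/-- The higher order tangent bundle: `T^0 X = X` and `T^(k+1) X = T (T^k X)`. -/
noncomputable def iterTangent (X : SmoothManifold.{u}) : ℕ → SmoothManifold.{u}
  | 0 => X
  | k + 1 => (X.iterTangent k).tangent

/-- The differential of `f : X → ℝ`, as a function on the tangent bundle,
`(x, v) ↦ Df(x) · v`. -/
noncomputable def diff (X : SmoothManifold.{u}) (f : X → ℝ) : X.tangent → ℝ :=
  fun p : TangentBundle X.I X => mfderiv X.I 𝓘(ℝ) f p.proj p.snd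

/-- The differential of order `k` of `f : X → ℝ`, as a function `D^k f : T^k X → ℝ`, that is
`D^0 f = f` and `D^(k+1) f = D (D^k f)`. -/
noncomputable def iterDiff (X : SmoothManifold.{u}) (f : X → ℝ) : (k : ℕ) → X.iterTangent k → ℝ
  | 0 => f
  | k + 1 => (X.iterTangent k).diff (X.iterDiff f k)

/-- `X.diffAt f k y v` is the number `D^(k+1) f (y) · v`, for `y ∈ T^k X` and `v ∈ T_y (T^k X)`. -/
noncomputable def diffAt (X : SmoothManifold.{u}) (f : X → ℝ) (k : ℕ) (y : X.iterTangent k)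
    (v : TangentSpace (X.iterTangent k).I y) : ℝ :=
  X.iterDiff f (k + 1) (⟨y, v⟩ : TangentBundle (X.iterTangent k).I (X.iterTangent k))

/-- A smooth Riemannian metric on `X`. -/
abbrev Metric (X : SmoothManifold.{u}) : Type u :=
  Bundle.ContMDiffRiemannianMetric X.I ∞ X.E (fun x : X => TangentSpace X.I x)

/-- The norm of a tangent vector for a Riemannian metric. -/
noncomputable def Metric.norm {X : SmoothManifold.{u}} (g : X.Metric) (x : X)
    (v : TangentSpace X.I x) : ℝ :=
  √(g.inner x v v)

/-- The Riemannian distance of `g`: the infimum of the lengths of `C^1` paths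
(it is infinite between different connected components). -/
noncomputable def Metric.edist {X : SmoothManifold.{u}} (g : X.Metric) (x y : X) : ℝ≥0∞ :=
  letI : ∀ z : X, ENorm (TangentSpace X.I z) := fun z => ⟨fun v => ENNReal.ofReal (g.norm z v)⟩
  Manifold.riemannianEDist X.I x y

/-- A Riemannian metric is complete if every sequence which is Cauchy for the Riemannian distance
converges. -/
def Metric.IsComplete {X : SmoothManifold.{u}} (g : X.Metric) : Prop :=
  ∀ u : ℕ → X,
    (∀ ε : ℝ≥0∞, 0 < ε → ∃ N : ℕ, ∀ m ≥ N, ∀ n ≥ N, g.edist (u m) (u n) < ε) →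
      ∃ x : X, Filter.Tendsto u Filter.atTop (𝓝 x)

/-- A choice of a Riemannian metric on each of the higher order tangent bundles `T^k X`. -/
abbrev MetricFamily (X : SmoothManifold.{u}) : Type u :=
  ∀ k : ℕ, (X.iterTangent k).Metric

/-- The supremum norm `‖f‖_∞`. -/
noncomputable def supNorm (X : SmoothManifold.{u}) (f : X → ℝ) : ℝ≥0∞ :=
  ⨆ x : X, ENNReal.ofReal |f x|

/-- The supremum norm of the differential of order `k + 1`, namely
`sup |D^(k+1) f (y) · v| / ‖v‖` over `y ∈ T^k X` and `0 ≠ v ∈ T_y (T^k X)`. -/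
noncomputable def diffNorm (X : SmoothManifold.{u}) (g : X.MetricFamily) (f : X → ℝ) (k : ℕ) :
    ℝ≥0∞ :=
  ⨆ (y : X.iterTangent k) (v : TangentSpace (X.iterTangent k).I y) (_ : v ≠ 0),
    ENNReal.ofReal (|X.diffAt f k y v| / (g k).norm y v)

/-- The norm `‖f‖_(C_b^n) = ‖f‖_∞ + ∑_(k=1)^n ‖D^k f‖_∞`, with values in `[0, ∞]`. -/
noncomputable def cbNorm (X : SmoothManifold.{u}) (g : X.MetricFamily) (n : ℕ) (f : X → ℝ) :
    ℝ≥0∞ :=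
  X.supNorm f + ∑ k ∈ Finset.range n, X.diffNorm g f k

/-- Membership in the space `C_b^n(X)` of functions with bounded differentials. -/
def MemCb (X : SmoothManifold.{u}) (g : X.MetricFamily) (n : ℕ) (f : X → ℝ) : Prop :=
  ContMDiff X.I 𝓘(ℝ) n f ∧ X.cbNorm g n f < ⊤

/-- `X.mixedDiffAt K k y v l z w` is the mixed differential `D^(k+1,l+1) K (y, z) · (v, w)`: first
the differential of order `k + 1` in the first variable, then the one of order `l + 1` in the
second. -/
noncomputable def mixedDiffAt (X : SmoothManifold.{u}) (K : X.prod X → ℝ)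
    (k : ℕ) (y : X.iterTangent k) (v : TangentSpace (X.iterTangent k).I y)
    (l : ℕ) (z : X.iterTangent l) (w : TangentSpace (X.iterTangent l).I z) : ℝ :=
  X.diffAt (fun x' : X => X.diffAt (fun x : X => K (x, x')) k y v) l z w

/-- The supremum norm of `D^(k+1,k+1) K`, for a function `K` of two variables:
`sup |D^(k+1,k+1) K (y, z) · (v, w)| / (‖v‖ ‖w‖)`. -/
noncomputable def mixedDiffNorm (X : SmoothManifold.{u}) (g : X.MetricFamily)
    (K : X.prod X → ℝ) (k : ℕ) : ℝ≥0∞ :=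
  ⨆ (y : X.iterTangent k) (v : TangentSpace (X.iterTangent k).I y) (_ : v ≠ 0)
    (z : X.iterTangent k) (w : TangentSpace (X.iterTangent k).I z) (_ : w ≠ 0),
    ENNReal.ofReal
      (|X.mixedDiffAt K k y v k z w| / ((g k).norm y v * (g k).norm z w))

/-- The metrics `G` on the bundles `T^j (X × X)` are compatible up to order `s` with the metrics
`g` on the bundles `T^j X` if measuring the mixed differential `D^(k,k) F` of a function on
`X × X` through `g` gives at most what measuring the full differential `D^(2k) F` through `G`
gives, for `1 ≤ k ≤ s` (here `k` is shifted by one). This restricts the metrics only. -/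
def MetricFamily.Compatible {X : SmoothManifold.{u}} (g : X.MetricFamily)
    (G : (X.prod X).MetricFamily) (s : ℕ) : Prop :=
  ∀ k < s, ∀ F : X.prod X → ℝ, ContMDiff (X.prod X).I 𝓘(ℝ) ((2 * (k + 1) : ℕ) : ℕ∞ω) F →
    X.mixedDiffNorm g F k ≤ (X.prod X).diffNorm G F (2 * k + 1)

end SmoothManifold

/-- A Mercer kernel on a set: a symmetric positive semidefinite function of two variables. -/
def IsMercerKernel {α : Type*} (K : α × α → ℝ) : Prop :=
  (∀ x y : α, K (x, y) = K (y, x)) ∧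
    ∀ (n : ℕ) (x : Fin n → α) (c : Fin n → ℝ), 0 ≤ ∑ i, ∑ j, c i * c j * K (x i, x j)

/-- The Hilbert space of functions `𝓗` is the reproducing kernel Hilbert space associated to `K`:
each section `K(x, ·)` belongs to `𝓗` and `f(x) = ⟨f, K(x, ·)⟩` for every `f ∈ 𝓗`. -/
def IsRKHSOf {α : Type*} (𝓗 : Type*) [NormedAddCommGroup 𝓗] [InnerProductSpace ℝ 𝓗]
    [RKHS ℝ 𝓗 α ℝ] (K : α × α → ℝ) : Prop :=
  ∀ x : α, ∃ k : 𝓗, (∀ y : α, k y = K (x, y)) ∧ ∀ f : 𝓗, f x = inner ℝ f k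

/-! ### Regularity of Hilbert-space-valued maps on normed spaces, read off from their kernels. -/

section FeatureMap

open Filter Set

variable {E H : Type*} [NormedAddCommGroup E] [NormedSpace ℝ E]
  [NormedAddCommGroup H] [InnerProductSpace ℝ H]

/-! All statements come from the feature map `Φ x = K(x, ·)` into `𝓗`, for which `K (x, y) = ⟨Φ x, Φ
y⟩`. The point is that `Φ` is `C^s` in norm once `K` is `C^(2s)`. Inner products of increments of
`Φ` are mixed second differences of `K`, so the difference quotients of `Φ` are Cauchy; the
derivative of `Φ` in a fixed direction has as kernel a mixed second derivative of `K`, and induction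
applies (`contDiffOn_of_contDiffOn_inner`, carried to manifolds by `contMDiff_of_contMDiff_inner`).

Since `f = ⟨f, Φ ·⟩` and a continuous linear functional commutes with differentials
(`iterDiff_clm_comp`), `D^k f = ⟨f, D^k Φ⟩`. Taking `f = Φ x` identifies `D^k Φ` with the
differentiated sections of `K`; taking `f` to be such a section gives its squared norm as a diagonal
value of `D^(k,k) K`. The norm bounds are then Cauchy–Schwarz, once in `𝓗` and once over the `s + 1`
orders. -/

/-- A map into a Hilbert space whose increments at a point have inner products asymptotic to a
bounded bilinear form is Fréchet differentiable at that point. -/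
theorem exists_hasFDerivAt_zero_of_inner_approx [CompleteSpace H] {Δ : E → H} (h0 : Δ 0 = 0)
    (B : E →L[ℝ] E →L[ℝ] ℝ)
    (hB : ∀ ε > 0, ∃ δ > 0, ∀ v w : E, ‖v‖ < δ → ‖w‖ < δ →
      |inner ℝ (Δ v) (Δ w) - B v w| ≤ ε * ‖v‖ * ‖w‖) :
    ∃ L : E →L[ℝ] H, HasFDerivAt Δ L 0 := by
  have small : ∀ (v : E) (δ : ℝ), 0 < δ → ∀ᶠ t in 𝓝[≠] (0 : ℝ), ‖t • v‖ < δ := by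
    intro v δ hδ
    have : Tendsto (fun t : ℝ => ‖t • v‖) (𝓝 0) (𝓝 0) := by
      have : Continuous (fun t : ℝ => ‖t • v‖) := by fun_prop
      simpa using this.tendsto 0
    exact (this.eventually_lt_const hδ).filter_mono nhdsWithin_le_nhds
  have nz : ∀ᶠ t in 𝓝[≠] (0 : ℝ), t ≠ 0 := eventually_mem_nhdsWithin
  set q : E → ℝ → H := fun v t => t⁻¹ • Δ (t • v) with hq
  -- The error in `hB` is a product `‖v‖ * ‖w‖`, so either argument can be rescaled to a difference
  -- quotient without loss, independently of the other.
  have half : ∀ ε > 0, ∃ δ > 0, ∀ v w : E, ‖v‖ < δ → ∀ t : ℝ, t ≠ 0 → ‖t • w‖ < δ →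
      |inner ℝ (Δ v) (q w t) - B v w| ≤ ε * ‖v‖ * ‖w‖ := by
    intro ε hε
    obtain ⟨δ, hδ, h⟩ := hB ε hε
    refine ⟨δ, hδ, fun v w hv t ht hw => ?_⟩
    have h1 := h v (t • w) hv hw
    have e : inner ℝ (Δ v) (q w t) - B v w
        = t⁻¹ * (inner ℝ (Δ v) (Δ (t • w)) - B v (t • w)) := by
      simp only [hq, inner_smul_right, map_smul, smul_eq_mul]
      field_simp
    rw [e, abs_mul, abs_inv, inv_mul_le_iff₀ (abs_pos.2 ht)]
    refine h1.trans (le_of_eq ?_)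
    rw [norm_smul, Real.norm_eq_abs]
    ring
  have lim : ∀ v w : E, Tendsto (fun p : ℝ × ℝ => inner ℝ (q v p.1) (q w p.2))
      (𝓝[≠] 0 ×ˢ 𝓝[≠] 0) (𝓝 (B v w)) := by
    intro v w
    rw [Metric.tendsto_nhds]
    intro ε hε
    have hc : 0 < ‖v‖ * ‖w‖ + 1 := by positivity
    obtain ⟨δ, hδ, h⟩ := half (ε / (‖v‖ * ‖w‖ + 1)) (by positivity)
    filter_upwards [((small v δ hδ).and nz).prod_mk ((small w δ hδ).and nz)] with p hp
    obtain ⟨⟨h1, h2⟩, h3, h4⟩ := hp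
    have h5 := h (p.1 • v) w h1 p.2 h4 h3
    have e : inner ℝ (q v p.1) (q w p.2) - B v w
        = p.1⁻¹ * (inner ℝ (Δ (p.1 • v)) (q w p.2) - B (p.1 • v) w) := by
      simp only [hq, real_inner_smul_left, map_smul, smul_eq_mul, smul_apply]
      field_simp
    rw [Real.dist_eq, e, abs_mul, abs_inv, inv_mul_lt_iff₀ (abs_pos.2 h2)]
    refine h5.trans_lt ?_
    rw [norm_smul, Real.norm_eq_abs]
    have : ε / (‖v‖ * ‖w‖ + 1) * (‖v‖ * ‖w‖) < ε := by
      rw [div_mul_eq_mul_div, div_lt_iff₀ hc]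
      nlinarith
    calc _ = |p.1| * (ε / (‖v‖ * ‖w‖ + 1) * (‖v‖ * ‖w‖)) := by ring
      _ < _ := by gcongr
  have diag : ∀ v : E, Tendsto (fun t : ℝ => inner ℝ (q v t) (q v t)) (𝓝[≠] 0) (𝓝 (B v v)) :=
    fun v => (lim v v).comp tendsto_diag
  -- Expanding `‖q v t - q v t'‖ ^ 2` gives the limit `B v v - 2 * B v v + B v v = 0`, so the
  -- quotients are Cauchy.
  have ex : ∀ v : E, ∃ l : H, Tendsto (q v) (𝓝[≠] 0) (𝓝 l) := by
    intro v
    rw [← cauchy_map_iff_exists_tendsto, cauchy_map_iff]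
    refine ⟨inferInstance, ?_⟩
    rw [tendsto_uniformity_iff_dist_tendsto_zero]
    have h1 : Tendsto (fun p : ℝ × ℝ => inner ℝ (q v p.1) (q v p.1) -
        2 * inner ℝ (q v p.1) (q v p.2) + inner ℝ (q v p.2) (q v p.2))
        (𝓝[≠] 0 ×ˢ 𝓝[≠] 0) (𝓝 (B v v - 2 * B v v + B v v)) :=
      (((diag v).comp tendsto_fst).sub ((lim v v).const_mul 2)).add ((diag v).comp tendsto_snd)
    have h2 := h1.sqrt
    rw [show B v v - 2 * B v v + B v v = 0 by ring, Real.sqrt_zero] at h2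
    refine h2.congr fun p => ?_
    rw [dist_eq_norm, ← Real.sqrt_sq (norm_nonneg (q v p.1 - q v p.2)), norm_sub_sq_real]
    simp only [real_inner_self_eq_norm_sq]
  choose L hL using ex
  have hLL : ∀ v w, inner ℝ (L v) (L w) = B v w := fun v w =>
    tendsto_nhds_unique (((hL v).comp tendsto_fst).inner ((hL w).comp tendsto_snd)) (lim v w)
  have eqz : ∀ x : H, inner ℝ x x = 0 → x = 0 := fun x hx => inner_self_eq_zero.1 hx
  -- The squared norm of the additivity defect expands through `hLL` into values of `B`, which
  -- cancel by bilinearity.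
  have hadd : ∀ v w, L (v + w) = L v + L w := by
    intro v w
    rw [← sub_eq_zero]
    apply eqz
    simp only [inner_sub_left, inner_sub_right, inner_add_left, inner_add_right, hLL, map_add,
      add_apply]
    ring
  have hsmul : ∀ (c : ℝ) v, L (c • v) = c • L v := by
    intro c v
    rw [← sub_eq_zero]
    apply eqz
    simp only [inner_sub_left, inner_sub_right, real_inner_smul_left, inner_smul_right, hLL,
      map_smul, smul_apply, smul_eq_mul]
    ring
  let Lin : E →ₗ[ℝ] H := { toFun := L, map_add' := hadd, map_smul' := hsmul }
  have bound : ∀ v, ‖Lin v‖ ≤ √‖B‖ * ‖v‖ := by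
    intro v
    refine abs_le_of_sq_le_sq' ?_ (by positivity) |>.2
    rw [mul_pow, Real.sq_sqrt (norm_nonneg B), ← real_inner_self_eq_norm_sq]
    change inner ℝ (L v) (L v) ≤ _
    rw [hLL]
    calc B v v ≤ ‖B v v‖ := le_abs_self _
      _ ≤ ‖B‖ * ‖v‖ * ‖v‖ := B.le_opNorm₂ v v
      _ = _ := by ring
  refine ⟨Lin.mkContinuous _ bound, ?_⟩
  rw [hasFDerivAt_iff_isLittleO_nhds_zero, Asymptotics.isLittleO_iff]
  intro c hc
  -- In `‖Δ v - L v‖ ^ 2 = ‖Δ v‖ ^ 2 - 2 * ⟨Δ v, L v⟩ + B v v` the first term is compared with `B v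
  -- v` once and the inner product twice; three errors add up to `c ^ 2 * ‖v‖ ^ 2`.
  obtain ⟨δ, hδ, h⟩ := hB (c ^ 2 / 3) (by positivity)
  obtain ⟨δ', hδ', h'⟩ := half (c ^ 2 / 3) (by positivity)
  filter_upwards [Metric.ball_mem_nhds (0 : E) (lt_min hδ hδ')] with v hv
  rw [mem_ball_zero_iff, lt_min_iff] at hv
  have h1 := h v v hv.1 hv.1
  have h2 : |inner ℝ (Δ v) (L v) - B v v| ≤ c ^ 2 / 3 * ‖v‖ * ‖v‖ := by
    refine le_of_tendsto (((tendsto_const_nhds.inner (hL v)).sub_const _).abs) ?_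
    filter_upwards [small v δ' hδ', nz] with t ht ht'
    exact h' v v hv.2 t ht' ht
  simp only [zero_add, h0, sub_zero, LinearMap.mkContinuous_apply]
  change ‖Δ v - L v‖ ≤ _
  refine abs_le_of_sq_le_sq' ?_ (by positivity) |>.2
  rw [norm_sub_sq_real, ← real_inner_self_eq_norm_sq, ← real_inner_self_eq_norm_sq, hLL]
  rw [abs_le] at h1 h2
  nlinarith

/-- A function of two variables of class `C^2` has mixed second differences approximated by its
mixed second derivative. -/
theorem ContDiffAt.mixed_difference_approx {k : E × E → ℝ} {x : E} (hk : ContDiffAt ℝ 2 k (x, x))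
    {ε : ℝ} (hε : 0 < ε) :
    ∃ δ > 0, ∀ a ∈ Metric.ball x δ, ∀ b ∈ Metric.ball x δ,
      ‖k (a, b) - k (a, x) - (k (x, b) - k (x, x))
        - fderiv ℝ (fderiv ℝ k) (x, x) (0, b - x) (a - x, 0)‖ ≤ ε * ‖b - x‖ * ‖a - x‖ := by
  have hk1 : ContDiffAt ℝ 1 (fderiv ℝ k) (x, x) := hk.fderiv_right (by norm_num)
  have hk2 : ContinuousAt (fderiv ℝ (fderiv ℝ k)) (x, x) :=
    (hk1.fderiv_right (m := 0) (by norm_num)).continuousAt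
  have hn : Tendsto (fun p => ‖fderiv ℝ (fderiv ℝ k) p - fderiv ℝ (fderiv ℝ k) (x, x)‖)
      (𝓝 (x, x)) (𝓝 0) := by
    exact tendsto_iff_norm_sub_tendsto_zero (E := E × E →L[ℝ] E × E →L[ℝ] ℝ) |>.1 hk2
  have ev : ∀ᶠ p in 𝓝 (x, x), DifferentiableAt ℝ k p ∧ DifferentiableAt ℝ (fderiv ℝ k) p ∧
      ‖fderiv ℝ (fderiv ℝ k) p - fderiv ℝ (fderiv ℝ k) (x, x)‖ ≤ ε := by
    filter_upwards [hk.eventually (by simp), hk1.eventually (by simp),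
      hn.eventually_lt_const hε] with p h1 h2 h3
    exact ⟨h1.differentiableAt (by norm_num), h2.differentiableAt (by norm_num),
      h3.le⟩
  obtain ⟨δ, hδ, h⟩ := Metric.eventually_nhds_iff_ball.1 ev
  refine ⟨δ, hδ, fun a ha b hb => ?_⟩
  have mem : ∀ {a b : E}, a ∈ Metric.ball x δ → b ∈ Metric.ball x δ →
      (a, b) ∈ Metric.ball (x, x) δ := fun ha hb => by
    rw [← ball_prod_same]; exact ⟨ha, hb⟩
  have hx := Metric.mem_ball_self (x := x) hδ
  set T := fderiv ℝ (fderiv ℝ k) (x, x) with hT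
  -- Mean value inequality in the second variable for `fderiv ℝ k`; a second one, in the first
  -- variable for `a' ↦ k (a', b) - k (a', x)`, produces the product of both increments.
  have step : ∀ a' ∈ Metric.ball x δ,
      ‖fderiv ℝ k (a', b) - fderiv ℝ k (a', x) - T (0, b - x)‖ ≤ ε * ‖b - x‖ := by
    intro a' ha'
    have := (convex_ball (x, x) δ).norm_image_sub_le_of_norm_hasFDerivWithin_le' (φ := T)
      (f' := fderiv ℝ (fderiv ℝ k)) (f := fderiv ℝ k) (C := ε)
      (fun p hp => (h p hp).2.1.hasFDerivAt.hasFDerivWithinAt) (fun p hp => (h p hp).2.2)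
      (mem ha' hx) (mem ha' hb)
    simpa using this
  have := (convex_ball x δ).norm_image_sub_le_of_norm_hasFDerivWithin_le' (𝕜 := ℝ)
    (φ := (T (0, b - x)).comp (ContinuousLinearMap.inl ℝ E E))
    (f := fun a' => k (a', b) - k (a', x))
    (f' := fun a' => (fderiv ℝ k (a', b) - fderiv ℝ k (a', x)).comp
      (ContinuousLinearMap.inl ℝ E E)) (C := ε * ‖b - x‖) (fun a' ha' => ?_) (fun a' ha' => ?_)
      hx ha
  · simpa using this
  · have e : ∀ b ∈ Metric.ball x δ, HasFDerivAt (fun a' => k (a', b))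
        ((fderiv ℝ k (a', b)).comp (ContinuousLinearMap.inl ℝ E E)) a' := fun b hb =>
      (h _ (mem ha' hb)).1.hasFDerivAt.comp a' (hasFDerivAt_prodMk_left a' b)
    rw [ContinuousLinearMap.sub_comp]
    exact ((e b hb).sub (e x hx)).hasFDerivWithinAt
  · rw [← ContinuousLinearMap.sub_comp]
    refine (ContinuousLinearMap.opNorm_comp_le _ _).trans ?_
    refine (mul_le_of_le_one_right (norm_nonneg _) (ContinuousLinearMap.norm_inl_le_one ℝ E E)).trans ?_
    exact step a' ha'

/-- A map into a Hilbert space is differentiable wherever its kernel is of class `C^2`. -/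
theorem differentiableAt_of_contDiffAt_inner [CompleteSpace H] {Φ : E → H} {k : E × E → ℝ} {x : E}
    (hΦ : ∀ᶠ p in 𝓝 (x, x), k p = inner ℝ (Φ p.1) (Φ p.2)) (hk : ContDiffAt ℝ 2 k (x, x)) :
    DifferentiableAt ℝ Φ x := by
  replace hk : ContDiffAt ℝ 2 (fun p : E × E => inner ℝ (Φ p.1) (Φ p.2)) (x, x) :=
    hk.congr_of_eventuallyEq (hΦ.mono fun p hp => hp.symm)
  set k' : E × E → ℝ := fun p : E × E => inner ℝ (Φ p.1) (Φ p.2) with hk'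
  let B : E →L[ℝ] E →L[ℝ] ℝ := (((ContinuousLinearMap.compL ℝ E (E × E) ℝ).flip
    (ContinuousLinearMap.inl ℝ E E)).comp
      ((fderiv ℝ (fderiv ℝ k') (x, x)).comp (ContinuousLinearMap.inr ℝ E E))).flip
  obtain ⟨L, hL⟩ := exists_hasFDerivAt_zero_of_inner_approx
    (Δ := fun v => Φ (x + v) - Φ x) (by simp) B (fun ε hε => by
      obtain ⟨δ, hδ, h⟩ := hk.mixed_difference_approx hε
      refine ⟨δ, hδ, fun v w hv hw => ?_⟩
      have := h (x + v) (by simpa using hv) (x + w) (by simpa using hw)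
      simp only [add_sub_cancel_left, Real.norm_eq_abs, hk'] at this
      have e : inner ℝ (Φ (x + v) - Φ x) (Φ (x + w) - Φ x) - B v w
          = inner ℝ (Φ (x + v)) (Φ (x + w)) - inner ℝ (Φ (x + v)) (Φ x)
            - (inner ℝ (Φ x) (Φ (x + w)) - inner ℝ (Φ x) (Φ x))
            - fderiv ℝ (fderiv ℝ k') (x, x) (0, w) (v, 0) := by
        simp only [inner_sub_left, inner_sub_right]
        have : B v w = fderiv ℝ (fderiv ℝ k') (x, x) (0, w) (v, 0) := by simp [B]
        rw [this]; ring
      rw [e]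
      refine this.trans (le_of_eq (by ring)))
  have h1 : HasFDerivAt (fun y => Φ (x + (y - x)) - Φ x) L x := by
    have h2 : HasFDerivAt (fun v => Φ (x + v) - Φ x) L (x - x) := by rwa [sub_self]
    exact h2.comp x (f := fun y => y - x) ((hasFDerivAt_id x).sub_const x)
  have h3 : HasFDerivAt (fun y => Φ y - Φ x) L x := by simpa using h1
  simpa using (h3.add_const (Φ x)).differentiableAt

/-- If the kernel of a map into a Hilbert space is of class `C^(2n)`, the map is of class
`C^n`. -/
theorem contDiffOn_of_contDiffOn_inner [FiniteDimensional ℝ E] [CompleteSpace H] {U : Set E}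
    (hU : IsOpen U) (n : ℕ) {Φ : E → H} {k : E × E → ℝ}
    (hΦ : ∀ a ∈ U, ∀ b ∈ U, k (a, b) = inner ℝ (Φ a) (Φ b))
    (hk : ContDiffOn ℝ (2 * n : ℕ) k (U ×ˢ U)) : ContDiffOn ℝ n Φ U := by
  induction n generalizing Φ k with
  | zero =>
    rw [Nat.cast_zero, contDiffOn_zero]
    have hc : ContinuousOn k (U ×ˢ U) := hk.continuousOn
    intro x hx
    -- On `U` this function is `‖Φ a - Φ x‖ ^ 2`.
    have h1 : ContinuousWithinAt (fun a => k (a, a) - 2 * k (a, x) + k (x, x)) U x := by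
      have c1 : ContinuousWithinAt (fun a => k (a, a)) U x :=
        (hc (x, x) ⟨hx, hx⟩).comp (f := fun a => (a, a)) (by fun_prop) fun a ha => ⟨ha, ha⟩
      have c2 : ContinuousWithinAt (fun a => k (a, x)) U x :=
        (hc (x, x) ⟨hx, hx⟩).comp (f := fun a => (a, x)) (by fun_prop) fun a ha => ⟨ha, hx⟩
      exact (c1.sub (c2.const_mul 2)).add continuousWithinAt_const
    rw [ContinuousWithinAt, tendsto_iff_dist_tendsto_zero]
    have h2 := Tendsto.sqrt h1
    beta_reduce at h2
    rw [show k (x, x) - 2 * k (x, x) + k (x, x) = 0 by ring, Real.sqrt_zero] at h2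
    refine h2.congr' ?_
    filter_upwards [self_mem_nhdsWithin] with a ha
    rw [dist_eq_norm, ← Real.sqrt_sq (norm_nonneg (Φ a - Φ x)), norm_sub_sq_real, hΦ a ha a ha,
      hΦ a ha x hx, hΦ x hx x hx]
    simp only [real_inner_self_eq_norm_sq]
  | succ n ih =>
    have hUU : IsOpen (U ×ˢ U) := hU.prod hU
    have near : ∀ a ∈ U, ∀ b ∈ U, ∀ᶠ p in 𝓝 (a, b), k p = inner ℝ (Φ p.1) (Φ p.2) :=
      fun a ha b hb => by
        filter_upwards [hUU.mem_nhds ⟨ha, hb⟩] with p hp using hΦ p.1 hp.1 p.2 hp.2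
    have hd : ∀ x ∈ U, DifferentiableAt ℝ Φ x := fun x hx =>
      differentiableAt_of_contDiffAt_inner (near x hx x hx)
        ((hk.contDiffAt (hUU.mem_nhds ⟨hx, hx⟩)).of_le (by norm_cast; omega))
    rw [Nat.cast_succ, contDiffOn_succ_iff_fderiv_of_isOpen hU]
    refine ⟨fun x hx => (hd x hx).differentiableWithinAt, by simp, ?_⟩
    -- In finite dimension it suffices to treat each direction `v`. The map `a ↦ fderiv ℝ Φ a v` has
    -- kernel `∂₂∂₁k` along `v` in both variables, of class `C^(2n)`, so the induction hypothesis
    -- applies to it.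
    rw [contDiffOn_clm_apply]
    intro v
    have hk1 : ContDiffOn ℝ (2 * n + 1 : ℕ) (fun p => fderiv ℝ k p (v, 0)) (U ×ˢ U) :=
      (hk.fderiv_of_isOpen hUU (by norm_cast)).clm_apply contDiffOn_const
    have hk2 : ContDiffOn ℝ (2 * n : ℕ)
        (fun p => fderiv ℝ (fun p => fderiv ℝ k p (v, 0)) p (0, v)) (U ×ˢ U) :=
      (hk1.fderiv_of_isOpen hUU (by norm_cast)).clm_apply contDiffOn_const
    have e1 : ∀ a ∈ U, ∀ b ∈ U, fderiv ℝ k (a, b) (v, 0) = inner ℝ (fderiv ℝ Φ a v) (Φ b) := by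
      intro a ha b hb
      have hkd : DifferentiableAt ℝ k (a, b) :=
        (hk.contDiffAt (hUU.mem_nhds ⟨ha, hb⟩)).differentiableAt (by norm_cast)
      have h1 : HasFDerivAt (fun a' => k (a', b))
          ((fderiv ℝ k (a, b)).comp (ContinuousLinearMap.inl ℝ E E)) a :=
        hkd.hasFDerivAt.comp a (hasFDerivAt_prodMk_left a b)
      have h2 : HasFDerivAt (fun a' => k (a', b)) ((innerSL ℝ (Φ b)).comp (fderiv ℝ Φ a)) a := by
        refine ((innerSL ℝ (Φ b)).hasFDerivAt.comp a (hd a ha).hasFDerivAt).congr_of_eventuallyEq ?_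
        filter_upwards [hU.mem_nhds ha] with a' ha'
        simp [hΦ a' ha' b hb, real_inner_comm]
      simpa [real_inner_comm] using congr($(h1.unique h2) v)
    have e2 : ∀ a ∈ U, ∀ b ∈ U, fderiv ℝ (fun p => fderiv ℝ k p (v, 0)) (a, b) (0, v)
        = inner ℝ (fderiv ℝ Φ a v) (fderiv ℝ Φ b v) := by
      intro a ha b hb
      have hkd : DifferentiableAt ℝ (fun p => fderiv ℝ k p (v, 0)) (a, b) :=
        (hk1.contDiffAt (hUU.mem_nhds ⟨ha, hb⟩)).differentiableAt (by norm_cast)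
      have h1 : HasFDerivAt (fun b' => fderiv ℝ k (a, b') (v, 0))
          ((fderiv ℝ (fun p => fderiv ℝ k p (v, 0)) (a, b)).comp
            (ContinuousLinearMap.inr ℝ E E)) b :=
        hkd.hasFDerivAt.comp b (hasFDerivAt_prodMk_right a b)
      have h2 : HasFDerivAt (fun b' => fderiv ℝ k (a, b') (v, 0))
          ((innerSL ℝ (fderiv ℝ Φ a v)).comp (fderiv ℝ Φ b)) b := by
        refine ((innerSL ℝ (fderiv ℝ Φ a v)).hasFDerivAt.comp b
          (hd b hb).hasFDerivAt).congr_of_eventuallyEq ?_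
        filter_upwards [hU.mem_nhds hb] with b' hb'
        simp [e1 a ha b' hb']
      simpa using congr($(h1.unique h2) v)
    exact ih e2 hk2

end FeatureMap

/-! ### Iterated differentials of vector-valued maps on manifolds. -/

namespace SmoothManifold

variable {H : Type*} [NormedAddCommGroup H]

section

variable [NormedSpace ℝ H]

/-- The differential of a vector-valued map `Φ : X → H`, as a map on the tangent bundle. -/
noncomputable def vecDiff (X : SmoothManifold.{u}) (Φ : X → H) : X.tangent → H :=
  fun p : TangentBundle X.I X => mfderiv X.I 𝓘(ℝ, H) Φ p.proj p.snd

/-- The iterated differential of a vector-valued map `Φ : X → H`. -/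
noncomputable def iterVecDiff (X : SmoothManifold.{u}) (Φ : X → H) :
    (k : ℕ) → X.iterTangent k → H
  | 0 => Φ
  | k + 1 => (X.iterTangent k).vecDiff (X.iterVecDiff Φ k)

theorem contMDiff_vecDiff (X : SmoothManifold.{u}) {Φ : X → H} {n : ℕ}
    (hΦ : ContMDiff X.I 𝓘(ℝ, H) (n + 1 : ℕ) Φ) :
    ContMDiff X.tangent.I 𝓘(ℝ, H) n (X.vecDiff Φ) := by
  have : IsManifold X.I 1 X := IsManifold.of_le (n := ∞) (by simp)
  have h1 : ContMDiff X.I.tangent 𝓘(ℝ, H).tangent n (tangentMap X.I 𝓘(ℝ, H) Φ) :=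
    hΦ.contMDiff_tangentMap (by norm_cast)
  exact (contMDiff_snd_tangentBundle_modelSpace H 𝓘(ℝ, H)).comp h1

theorem contMDiff_iterVecDiff (X : SmoothManifold.{u}) {Φ : X → H} {n : ℕ} (k : ℕ)
    (hΦ : ContMDiff X.I 𝓘(ℝ, H) (n + k : ℕ) Φ) :
    ContMDiff (X.iterTangent k).I 𝓘(ℝ, H) n (X.iterVecDiff Φ k) := by
  induction k generalizing n with
  | zero => exact hΦ
  | succ k ih => exact contMDiff_vecDiff _ (ih (n := n + 1) (by convert! hΦ using 2; omega))

theorem diff_clm_comp (X : SmoothManifold.{u}) {Φ : X → H} (hΦ : MDifferentiable X.I 𝓘(ℝ, H) Φ)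
    (L : H →L[ℝ] ℝ) : X.diff (fun x => L (Φ x)) = fun p => L (X.vecDiff Φ p) := by
  funext p
  change TangentBundle X.I X at p
  have h := (L.hasMFDerivAt (x := Φ p.proj)).comp p.proj (hΦ p.proj).hasMFDerivAt
  exact congr($(h.mfderiv) p.snd)

/-- Iterated differentials commute with continuous linear functionals. -/
theorem iterDiff_clm_comp (X : SmoothManifold.{u}) {Φ : X → H} {n : ℕ}
    (hΦ : ContMDiff X.I 𝓘(ℝ, H) n Φ) (L : H →L[ℝ] ℝ) {k : ℕ} (hk : k ≤ n) :
    X.iterDiff (fun x => L (Φ x)) k = fun p => L (X.iterVecDiff Φ k p) := by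
  induction k with
  | zero => rfl
  | succ k ih =>
    have h1 : ContMDiff (X.iterTangent k).I 𝓘(ℝ, H) (1 : ℕ) (X.iterVecDiff Φ k) :=
      contMDiff_iterVecDiff X k (hΦ.of_le (by norm_cast; omega))
    change (X.iterTangent k).diff (X.iterDiff (fun x => L (Φ x)) k) = _
    rw [ih (by omega)]
    exact diff_clm_comp _ (h1.mdifferentiable (by simp)) L

end

variable [InnerProductSpace ℝ H]

/-- A map into a Hilbert space is of class `C^n` if its kernel is of class `C^(2n)`. -/
theorem contMDiff_of_contMDiff_inner [CompleteSpace H] (X : SmoothManifold.{u}) {Φ : X → H}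
    {K : X.prod X → ℝ} (hK : ∀ x y : X, K (x, y) = inner ℝ (Φ x) (Φ y)) {n : ℕ}
    (hKn : ContMDiff (X.prod X).I 𝓘(ℝ) (2 * n : ℕ) K) : ContMDiff X.I 𝓘(ℝ, H) n Φ := by
  intro x
  let K' : X × X → ℝ := K
  have hKn' : ContMDiff (X.I.prod X.I) 𝓘(ℝ) (2 * n : ℕ) K' := hKn
  have : IsManifold X.I (2 * n : ℕ) X := IsManifold.of_le (n := ∞) (by simpa using WithTop.coe_le_coe.2 (le_top : ((2 * n : ℕ) : ℕ∞) ≤ ⊤))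
  have : IsManifold X.I n X := IsManifold.of_le (n := ∞) (by simpa using WithTop.coe_le_coe.2 (le_top : (n : ℕ∞) ≤ ⊤))
  have hU : IsOpen (extChartAt X.I x).target := isOpen_extChartAt_target x
  have hs : ContMDiffOn 𝓘(ℝ, X.E) X.I (2 * n : ℕ) (extChartAt X.I x).symm
      (extChartAt X.I x).target := contMDiffOn_extChartAt_symm x
  -- The same chart is used in both variables: only the kernel near the diagonal point `(x, x)`
  -- matters.
  have hk : ContDiffOn ℝ (2 * n : ℕ)
      (fun p : X.E × X.E => K' ((extChartAt X.I x).symm p.1, (extChartAt X.I x).symm p.2))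
      ((extChartAt X.I x).target ×ˢ (extChartAt X.I x).target) := by
    rw [← contMDiffOn_iff_contDiffOn]
    exact hKn'.comp_contMDiffOn
      ((hs.comp contDiff_fst.contMDiff.contMDiffOn fun _ hp => hp.1).prodMk
        (hs.comp contDiff_snd.contMDiff.contMDiffOn fun _ hp => hp.2))
  have h1 : ContDiffOn ℝ n (Φ ∘ (extChartAt X.I x).symm) (extChartAt X.I x).target :=
    contDiffOn_of_contDiffOn_inner hU n (fun a _ b _ => hK _ _) hk
  have h2 : ContMDiffOn X.I 𝓘(ℝ, X.E) n (extChartAt X.I x) (chartAt X.H x).source :=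
    contMDiffOn_extChartAt
  have h3 : ContMDiffOn X.I 𝓘(ℝ, H) n ((Φ ∘ (extChartAt X.I x).symm) ∘ extChartAt X.I x)
      (chartAt X.H x).source :=
    h1.contMDiffOn.comp h2 fun y hy =>
      (extChartAt X.I x).map_source (by rwa [extChartAt_source])
  have h4 : (chartAt X.H x).source ∈ 𝓝 x := chart_source_mem_nhds X.H x
  refine (h3.contMDiffAt h4).congr_of_eventuallyEq ?_
  filter_upwards [h4] with y hy
  exact congrArg Φ ((extChartAt X.I x).left_inv (by rwa [extChartAt_source])).symm

end SmoothManifold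

/-! ### Summing over the orders, and the main theorem. -/

/-- The sum of square roots is at most the square root of the number of terms times the sum. -/
theorem ENNReal.add_sum_rpow_half_le (a : ℝ≥0∞) (b : ℕ → ℝ≥0∞) (n : ℕ) :
    a ^ (1 / 2 : ℝ) + ∑ k ∈ Finset.range n, b k ^ (1 / 2 : ℝ)
      ≤ ((n + 1) * (a + ∑ k ∈ Finset.range n, b k)) ^ (1 / 2 : ℝ) := by
  -- Cauchy–Schwarz against the constant `1`; `Nat.casesOn` places `a` at index `0` and `b k` at
  -- index `k + 1`.
  have h := ENNReal.inner_le_Lp_mul_Lq (Finset.range (n + 1)) (fun _ => (1 : ℝ≥0∞))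
    (fun i => Nat.casesOn i a b ^ (1 / 2 : ℝ)) Real.HolderConjugate.two_two
  simp only [Finset.sum_range_succ', ← ENNReal.rpow_mul, one_mul, ENNReal.one_rpow,
    Finset.sum_const, Finset.card_range, nsmul_eq_mul, mul_one] at h
  norm_num at h
  rw [ENNReal.mul_rpow_of_nonneg _ _ (by norm_num), add_comm, add_comm a]
  simpa using h

theorem theorem3p2 (M : SmoothManifold.{u}) [T2Space M] [SecondCountableTopology M]
    -- complete Riemannian metrics on the bundles `T^k M` and `T^k (M × M)`
    (g : M.MetricFamily) (hg : ∀ k, (g k).IsComplete)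
    (G : (M.prod M).MetricFamily) (hG : ∀ k, (G k).IsComplete)
    -- a Mercer kernel of class `C_b^(2s+1)`
    (s : ℕ) (K : M.prod M → ℝ) (hK : IsMercerKernel (α := M) K)
    (hKs : (M.prod M).MemCb G (2 * s + 1) K)
    -- its reproducing kernel Hilbert space
    (𝓗 : Type*) [NormedAddCommGroup 𝓗] [InnerProductSpace ℝ 𝓗] [CompleteSpace 𝓗]
    [RKHS ℝ 𝓗 M ℝ] (h𝓗 : IsRKHSOf (α := M) 𝓗 K) :
    -- differentiated kernel sections of order `k + 1 ∈ {1, …, s}`, and their reproducing property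
    (∀ k < s, ∀ (y : M.iterTangent k) (v : TangentSpace (M.iterTangent k).I y),
      ∃ h : 𝓗, (∀ x : M, h x = M.diffAt (fun x' : M => K (x', x)) k y v) ∧
        ∀ f : 𝓗, M.diffAt f k y v = inner ℝ h f) ∧
    -- the functions in the space are of class `C^s`
    (∀ f : 𝓗, ContMDiff M.I 𝓘(ℝ) s f) ∧
    -- the bound in terms of the mixed differentials of `K`, in `[0, ∞]`
    (∀ f : 𝓗, M.cbNorm g s f ≤
      ((s + 1) * ((M.prod M).supNorm K + ∑ k ∈ Finset.range s, M.mixedDiffNorm g K k))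
        ^ (1 / 2 : ℝ) * ENNReal.ofReal ‖f‖) ∧
    -- the bounded inclusion in terms of the norm of `K`, for compatible metrics on `T^k M` and `T^k (M × M)`
    (g.Compatible G s → ∀ f : 𝓗, M.MemCb g s f ∧
      (M.cbNorm g s f).toReal ≤ √((s + 1) * ((M.prod M).cbNorm G (2 * s) K).toReal) * ‖f‖) := by
  obtain ⟨hKC, hKb⟩ := hKs
  choose Φ hΦ1 hΦ2 using h𝓗
  have hKΦ : ∀ x y : M, K (x, y) = inner ℝ (Φ x) (Φ y) := fun x y => by
    rw [← hΦ1 x y, hΦ2 y]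
  have hΦ : ContMDiff M.I 𝓘(ℝ, 𝓗) s Φ :=
    M.contMDiff_of_contMDiff_inner hKΦ (hKC.of_le (by norm_cast; omega))
  have hf : ∀ f : 𝓗, (f : M → ℝ) = fun x => innerSL ℝ f (Φ x) := fun f => funext fun x => hΦ2 x f
  set D : (k : ℕ) → (y : M.iterTangent k) → TangentSpace (M.iterTangent k).I y → 𝓗 :=
    fun k y v => M.iterVecDiff Φ (k + 1)
      (⟨y, v⟩ : TangentBundle (M.iterTangent k).I (M.iterTangent k)) with hD
  have rep : ∀ k < s, ∀ (y : M.iterTangent k) (v : TangentSpace (M.iterTangent k).I y) (f : 𝓗),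
      M.diffAt f k y v = inner ℝ (D k y v) f := by
    intro k hk y v f
    rw [hf f, real_inner_comm]
    exact congrFun (M.iterDiff_clm_comp hΦ (innerSL ℝ f) (k := k + 1) hk) _
  have sec : ∀ k < s, ∀ (y : M.iterTangent k) (v : TangentSpace (M.iterTangent k).I y) (x : M),
      D k y v x = M.diffAt (fun x' : M => K (x', x)) k y v := by
    intro k hk y v x
    -- By symmetry of `K` the function being differentiated is itself an element of `𝓗`, so `rep`
    -- applies to it.
    have e : (fun x' : M => K (x', x)) = (Φ x : M → ℝ) := by
      funext x'
      rw [hΦ1 x x', hK.1]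
    rw [e, rep k hk, hΦ2]
  have mixed : ∀ k < s, ∀ (y : M.iterTangent k) (v : TangentSpace (M.iterTangent k).I y),
      M.mixedDiffAt K k y v k y v = ‖D k y v‖ ^ 2 := by
    intro k hk y v
    -- The section `D k y v` lies in `𝓗`, so `rep` applies once more, now to `f = D k y v`.
    have e : (fun x' : M => M.diffAt (fun x : M => K (x, x')) k y v) = (D k y v : M → ℝ) :=
      funext fun x' => (sec k hk y v x').symm
    rw [SmoothManifold.mixedDiffAt, e, rep k hk, real_inner_self_eq_norm_sq]
  have sup : ∀ f : 𝓗, M.supNorm f ≤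
      (M.prod M).supNorm K ^ (1 / 2 : ℝ) * ENNReal.ofReal ‖f‖ := by
    intro f
    refine iSup_le fun x => ?_
    have h1 : |f x| ≤ √|K (x, x)| * ‖f‖ := by
      rw [hΦ2, hKΦ, real_inner_self_eq_norm_sq, abs_sq, Real.sqrt_sq (norm_nonneg _), mul_comm]
      exact abs_real_inner_le_norm _ _
    refine (ENNReal.ofReal_le_ofReal h1).trans ?_
    rw [ENNReal.ofReal_mul (Real.sqrt_nonneg _), Real.sqrt_eq_rpow,
      ← ENNReal.ofReal_rpow_of_nonneg (abs_nonneg _) (by norm_num)]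
    gcongr
    exact le_iSup (fun p : M.prod M => ENNReal.ofReal |K p|) (x, x)
  have dif : ∀ k < s, ∀ f : 𝓗, M.diffNorm g f k ≤
      M.mixedDiffNorm g K k ^ (1 / 2 : ℝ) * ENNReal.ofReal ‖f‖ := by
    intro k hk f
    refine iSup_le fun y => iSup_le fun v => iSup_le fun hv => ?_
    have hn : 0 ≤ (g k).norm y v := Real.sqrt_nonneg _
    have h1 : |M.diffAt f k y v| / (g k).norm y v ≤
        √(|M.mixedDiffAt K k y v k y v| / ((g k).norm y v * (g k).norm y v)) * ‖f‖ := by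
      rw [mixed k hk, abs_sq, ← sq ((g k).norm y v), ← div_pow, Real.sqrt_sq (by positivity),
        div_mul_eq_mul_div, rep k hk]
      gcongr
      exact abs_real_inner_le_norm _ _
    refine (ENNReal.ofReal_le_ofReal h1).trans ?_
    rw [ENNReal.ofReal_mul (Real.sqrt_nonneg _), Real.sqrt_eq_rpow,
      ← ENNReal.ofReal_rpow_of_nonneg (by positivity) (by norm_num)]
    gcongr
    -- Only the diagonal `z = y`, `w = v` of the supremum is needed.
    exact le_iSup_of_le y <| le_iSup_of_le v <| le_iSup_of_le hv <| le_iSup_of_le y <|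
      le_iSup_of_le v <| le_iSup_of_le hv le_rfl
  have smooth : ∀ f : 𝓗, ContMDiff M.I 𝓘(ℝ) s f := fun f => by
    rw [hf f]
    exact (innerSL ℝ f).contMDiff.comp hΦ
  have bound : ∀ f : 𝓗, M.cbNorm g s f ≤
      ((s + 1) * ((M.prod M).supNorm K + ∑ k ∈ Finset.range s, M.mixedDiffNorm g K k))
        ^ (1 / 2 : ℝ) * ENNReal.ofReal ‖f‖ := by
    intro f
    calc M.cbNorm g s f
        ≤ (M.prod M).supNorm K ^ (1 / 2 : ℝ) * ENNReal.ofReal ‖f‖ +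
          ∑ k ∈ Finset.range s, M.mixedDiffNorm g K k ^ (1 / 2 : ℝ) * ENNReal.ofReal ‖f‖ :=
          add_le_add (sup f) (Finset.sum_le_sum fun k hk => dif k (Finset.mem_range.1 hk) f)
      _ = ((M.prod M).supNorm K ^ (1 / 2 : ℝ) +
          ∑ k ∈ Finset.range s, M.mixedDiffNorm g K k ^ (1 / 2 : ℝ)) * ENNReal.ofReal ‖f‖ := by
          rw [add_mul, Finset.sum_mul]
      _ ≤ _ := by
          gcongr
          exact ENNReal.add_sum_rpow_half_le _ _ s
  refine ⟨fun k hk y v => ⟨D k y v, sec k hk y v, rep k hk y v⟩, smooth, bound,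
    fun hgG f => ?_⟩
  have h1 : (M.prod M).supNorm K + ∑ k ∈ Finset.range s, M.mixedDiffNorm g K k
      ≤ (M.prod M).cbNorm G (2 * s) K := by
    refine add_le_add le_rfl ?_
    calc ∑ k ∈ Finset.range s, M.mixedDiffNorm g K k
        ≤ ∑ k ∈ Finset.range s, (M.prod M).diffNorm G K (2 * k + 1) :=
          Finset.sum_le_sum fun k hk => by
            have hk' := Finset.mem_range.1 hk
            exact hgG k hk' K (hKC.of_le (by norm_cast; omega))
      -- Index `2 * k + 1` stands for the differential of order `2 * (k + 1)`; these indices are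
      -- distinct and below `2 * s`, so the sum is part of the one in `cbNorm`.
      _ = ∑ j ∈ (Finset.range s).image (fun k => 2 * k + 1), (M.prod M).diffNorm G K j := by
          rw [Finset.sum_image]
          intro a _ b _ hab
          simpa using hab
      _ ≤ _ := by
          refine Finset.sum_le_sum_of_subset fun j hj => ?_
          simp only [Finset.mem_image, Finset.mem_range] at hj ⊢
          omega
  have h2 : (M.prod M).cbNorm G (2 * s) K < ⊤ := by
    refine lt_of_le_of_lt ?_ hKb
    exact add_le_add le_rfl (Finset.sum_le_sum_of_subset
      (Finset.range_subset_range.2 (Nat.le_succ _)))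
  have h3 : M.cbNorm g s f ≤
      ENNReal.ofReal (√((s + 1) * ((M.prod M).cbNorm G (2 * s) K).toReal) * ‖f‖) := by
    refine (bound f).trans ?_
    rw [ENNReal.ofReal_mul (Real.sqrt_nonneg _), Real.sqrt_eq_rpow,
      ← ENNReal.ofReal_rpow_of_nonneg (by positivity) (by norm_num),
      ENNReal.ofReal_mul (by positivity), ENNReal.ofReal_toReal h2.ne]
    have : ENNReal.ofReal ((s : ℝ) + 1) = (s : ℝ≥0∞) + 1 := by
      rw [ENNReal.ofReal_add (by positivity) zero_le_one]
      simp
    rw [this]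
    gcongr
  exact ⟨⟨smooth f, h3.trans_lt ENNReal.ofReal_lt_top⟩,
    ENNReal.toReal_le_of_le_ofReal (by positivity) h3⟩
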